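/- Let $R$ be a commutative Noetherian local ring with maximal ideal $\mathfrak m$ and $\dim R\ge 1$. Assume that $R$ is unmixed (every prime in $\operatorname{Ass}(R)$ is a minimal prime of $R$) and generically Gorenstein ($R_{\mathfrak p}$ is a Gorenstein ring for every $\mathfrak p\in\operatorname{Ass}(R)$). For a finitely generated $R$-module $N$ with minimal free presentation $F_1\xrightarrow{f}F_0\to N\to 0$, let $\Omega N=\operatorname{im} f$, let $\operatorname{Tr}N$ be the cokernel of $f^*\colon\operatorname{Hom}_R(F_0,R)\to\operatorname{Hom}_R(F_1,R)$, and let $\lambda N=\Omega\operatorname{Tr}N$. Finitely generated modules $N$ and $N'$ are horizontally linked if $N\cong\Omega\operatorname{Tr}N'$ and $N'\cong\Omega\operatorname{Tr}N$. Two non-zero proper ideals $I,J$ of $R$ are linked if $I=(0:_RJ)$ and $J=(0:_RI)$; they are geometrically linked if moreover $\operatorname{Ass}_R(R/I)\cap\operatorname{Ass}_R(R/J)=\emptyset$. Let $M$ be a non-zero finitely generated $R$-module that is horizontally linked to $\lambda M$ (equivalently, $M\cong\lambda\lambda M$). Then the following statements are equivalent: 1. $\operatorname{Ass}_R(M)\cap\operatorname{Ass}_R(\lambda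 M)=\emptyset$; 2. $\operatorname{Ann}_R(M)$ is geometrically linked to $\operatorname{Ann}_R(\lambda M)$; 3. $\operatorname{Ann}_R(M)$ is linked to $\operatorname{Ann}_R(\lambda M)$ and $\operatorname{Tor}_1^R(M,\lambda M)=0$; 4. $M$ is a free module over $R/\operatorname{Ann}_R(M)$ and $\operatorname{Ext}^1_R(M,M)=0$. -/

import Mathlib

open CategoryTheory

universe u

noncomputable section

namespace Linkage

section Rings

/-- A commutative ring is a Gorenstein local ring if it is a Noetherian local ring of finite
injective dimension as a module over itself. -/
structure IsGorensteinLocalRing (A : Type u) [CommRing A] : Prop where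
  isNoetherianRing : IsNoetherianRing A
  isLocalRing : IsLocalRing A
  injectiveDimension_ne_top : injectiveDimension (ModuleCat.of A A) ≠ ⊤

/-- `R` is generically Gorenstein if `R_𝔭` is Gorenstein for all `𝔭 ∈ Ass R`. -/
def IsGenericallyGorenstein (R : Type u) [CommRing R] : Prop :=
  ∀ (p : Ideal R) [p.IsPrime], p ∈ associatedPrimes R R →
    IsGorensteinLocalRing (Localization.AtPrime p)

/-- `R` is unmixed if `Ass R` consists of minimal prime ideals of `R`. -/
def IsUnmixedRing (R : Type u) [CommRing R] : Prop :=
  associatedPrimes R R ⊆ minimalPrimes R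

end Rings

section Ideals

variable {R : Type u} [CommRing R]

/-- Two non-zero proper ideals `I` and `J` are linked by an ideal `c ⊆ I ∩ J` if
`I = (c : J)` and `J = (c : I)`. -/
structure IsLinkedBy (c I J : Ideal R) : Prop where
  left_ne_bot : I ≠ ⊥
  left_ne_top : I ≠ ⊤
  right_ne_bot : J ≠ ⊥
  right_ne_top : J ≠ ⊤
  le_inf : c ≤ I ⊓ J
  left_eq : I = Submodule.colon c (J : Set R)
  right_eq : J = Submodule.colon c (I : Set R)

/-- `I` and `J` are geometrically linked by `c` if they are linked by `c` and
`Ass (R/I) ∩ Ass (R/J) = ∅`. -/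
structure IsGeometricallyLinkedBy (c I J : Ideal R) : Prop extends IsLinkedBy c I J where
  disjoint_ass : associatedPrimes R (R ⧸ I) ∩ associatedPrimes R (R ⧸ J) = ∅

/-- `I` is linked to `J` if they are linked by the zero ideal. -/
def IsLinked (I J : Ideal R) : Prop := IsLinkedBy ⊥ I J

/-- `I` is geometrically linked to `J` if they are geometrically linked by the zero ideal. -/
def IsGeometricallyLinked (I J : Ideal R) : Prop := IsGeometricallyLinkedBy ⊥ I J

end Ideals

section Modules

variable (R : Type u) [CommRing R] [IsLocalRing R]
variable (M : Type*) [AddCommGroup M] [Module R M]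

/-- A minimal free presentation `F₁ --f--> F₀ --g--> M → 0` of a module over a local ring
`(R, 𝔪)`: `F₁ = R^m` and `F₀ = R^n` are finite free, the sequence is exact, and the kernels of
`g` and of `f` are contained in `𝔪 F₀` and `𝔪 F₁` (that is, the coordinates of
their elements lie in `𝔪`). -/
structure MinimalPresentation where
  /-- the rank of `F₁` -/
  m : ℕ
  /-- the rank of `F₀` -/
  n : ℕ
  /-- the map `F₁ → F₀` -/
  f : (Fin m → R) →ₗ[R] (Fin n → R)
  /-- the map `F₀ → M` -/
  g : (Fin n → R) →ₗ[R] M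
  surjective : Function.Surjective g
  exact : Function.Exact f g
  ker_g_minimal : ∀ x ∈ LinearMap.ker g, ∀ i, x i ∈ IsLocalRing.maximalIdeal R
  ker_f_minimal : ∀ x ∈ LinearMap.ker f, ∀ i, x i ∈ IsLocalRing.maximalIdeal R

/-- Every finitely generated module over a local ring has a minimal free cover. -/
theorem exists_minimalCover [Module.Finite R M] :
    ∃ (n : ℕ) (g : (Fin n → R) →ₗ[R] M), Function.Surjective g ∧
      ∀ x ∈ LinearMap.ker g, ∀ i, x i ∈ IsLocalRing.maximalIdeal R := by
  classical
  have hex : ∃ (n : ℕ) (g : (Fin n → R) →ₗ[R] M), Function.Surjective g :=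
    Module.Finite.exists_fin' R M
  obtain ⟨g, hg⟩ := Nat.find_spec hex
  have hmin : ∀ k < Nat.find hex, ¬ ∃ g : (Fin k → R) →ₗ[R] M, Function.Surjective g :=
    fun k hk => Nat.find_min hex hk
  generalize Nat.find hex = n at g hmin
  refine ⟨n, g, hg, fun x hx i => ?_⟩
  by_contra hxi
  rw [IsLocalRing.mem_maximalIdeal, mem_nonunits_iff, not_not] at hxi
  obtain ⟨c, hc⟩ := hxi.exists_left_inv
  cases n with
  | zero => exact i.elim0
  | succ k =>
    refine hmin k k.lt_succ_self
      ⟨g ∘ₗ Function.ExtendByZero.linearMap R i.succAbove, fun y => ?_⟩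
    obtain ⟨z, rfl⟩ := hg y
    let w : Fin (k + 1) → R := z - (z i * c) • x
    refine ⟨w ∘ i.succAbove, ?_⟩
    have hw : Function.ExtendByZero.linearMap R i.succAbove (w ∘ i.succAbove) = w := by
      funext j
      rw [Function.ExtendByZero.linearMap_apply]
      rcases Fin.eq_self_or_eq_succAbove i j with rfl | ⟨l, rfl⟩
      · rw [Function.extend_apply' _ _ _ (by rintro ⟨a, ha⟩; exact Fin.succAbove_ne _ _ ha)]
        simp [w, mul_assoc, hc]
      · rw [Fin.succAbove_right_injective.extend_apply]
        rfl
    rw [LinearMap.comp_apply, hw]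
    simp [w, LinearMap.mem_ker.1 hx]

/-- Every finitely generated module over a Noetherian local ring has a minimal free
presentation. -/
theorem nonempty_minimalPresentation [IsNoetherianRing R] [Module.Finite R M] :
    Nonempty (MinimalPresentation R M) := by
  obtain ⟨n, g, hg, hgm⟩ := exists_minimalCover R M
  obtain ⟨m, f, hf, hfm⟩ := exists_minimalCover R (LinearMap.ker g)
  refine ⟨⟨m, n, (LinearMap.ker g).subtype ∘ₗ f, g, hg, ?_, hgm, ?_⟩⟩
  · rw [LinearMap.exact_iff, LinearMap.range_comp, LinearMap.range_eq_top.2 hf,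
      Submodule.map_top, Submodule.range_subtype]
  · intro x hx
    refine hfm x ?_
    rw [LinearMap.mem_ker, LinearMap.comp_apply] at hx
    exact LinearMap.mem_ker.2 (Subtype.ext hx)

variable [IsNoetherianRing R] [Module.Finite R M]

/-- A chosen minimal free presentation (it is unique up to isomorphism). -/
def minimalPresentation : MinimalPresentation R M :=
  (nonempty_minimalPresentation R M).some

/-- The first syzygy `Ω M`: the image of `f : F₁ → F₀` in a minimal free presentation. -/
abbrev Syzygy : Type u :=
  LinearMap.range (minimalPresentation R M).f

/-- The transpose `Tr M`: the cokernel of `f^* : Hom(F₀, R) → Hom(F₁, R)` for a minimal free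
presentation `F₁ → F₀ → M → 0`. -/
abbrev Transpose : Type u :=
  Module.Dual R (Fin (minimalPresentation R M).m → R) ⧸
    LinearMap.range (minimalPresentation R M).f.dualMap

/-- `λ M = Ω Tr M`. -/
abbrev Lam : Type u := Syzygy R (Transpose R M)

/-- `M` is horizontally linked to `N` if `M ≅ Ω Tr N` and `N ≅ Ω Tr M`. -/
def IsHorizontallyLinked (N : Type*) [AddCommGroup N] [Module R N] [Module.Finite R N] : Prop :=
  Nonempty (M ≃ₗ[R] Syzygy R (Transpose R N)) ∧ Nonempty (N ≃ₗ[R] Syzygy R (Transpose R M))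

end Modules

section HomologicalVanishing

variable (R : Type u) [CommRing R] (M N : Type u) [AddCommGroup M] [Module R M]
  [AddCommGroup N] [Module R N]

/-- `Tor_1^R(M, N) = 0`. -/
def TorOneVanishes : Prop :=
  Limits.IsZero (((Tor (ModuleCat.{u} R) 1).obj (ModuleCat.of R M)).obj (ModuleCat.of R N))

/-- `Ext^1_R(M, N) = 0`. -/
def ExtOneVanishes : Prop :=
  Subsingleton (Abelian.Ext (ModuleCat.of R M) (ModuleCat.of R N) 1)

/-- `M` is a free module over `R / Ann_R(M)`. -/
def IsFreeOverQuotientAnnihilator : Prop :=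
  letI : Module (R ⧸ Module.annihilator R M) M := Module.quotientAnnihilator
  Module.Free (R ⧸ Module.annihilator R M) M

end HomologicalVanishing

end Linkage

end

/-! Let `F₁ → F₀ → M → 0` be the minimal presentation `f`, `g`, and put `N = λM`, `I = Ann M`, `J =
Ann N`. By minimality `N ≅ im f^*`, so `J` consists of the `r` with `r • f = 0`, and since `I F₀ ⊆
im f` this forces `IJ = 0`. As `M ≅ λλM`, both modules embed in free modules, so their associated
primes lie in `Ass R`. Unmixedness then turns statement 1 into: no `p ∈ Ass R` contains both `I` and
`J`. All four statements are compared with this one in `tfae_of_minimalPresentation`.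

If it holds, testing at associated primes gives `I = (0 : J)`, `J = (0 : I)`, `I ∩ J = 0` and
`Hom(ΩM, M) = 0`. Linkage puts `ker g` inside `I F₀`, so `M ≅ (R/I)^n`, and makes functionals in
`ker f^*` take values in `J`; `Tor₁` then vanishes by `lTensor_subtype_injective`.

Conversely, suppose `p ∈ Ass R` contains `I` and `J`. If `I` and `J` are linked and `p = Ann x`,
then `x ∈ I ∩ J`, and `x` produces a non-zero element of `Tor₁(M, N)`, detected by `evalPairing`. If
`M` is free over `R/I`, a non-zero map `I → R/p ↪ M` yields a map `ker g → M` that does not extend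
to `F₀`, so `Ext¹(M, M) ≠ 0`. -/

namespace Linkage

/-! ### Vanishing of Tor₁ through a projective cover -/

section Tor

open TensorProduct

variable {R : Type u} [CommRing R]

/-- Whether `X ⊗ ker q → X ⊗ P` is injective does not depend on the projective cover `q`. -/
theorem lTensor_ker_injective_of_projective {X N P P' : Type*} [AddCommGroup X] [Module R X]
    [AddCommGroup N] [Module R N] [AddCommGroup P] [Module R P] [AddCommGroup P'] [Module R P']
    [Module.Projective R P] [Module.Projective R P']
    {q : P →ₗ[R] N} {q' : P' →ₗ[R] N} (hq : Function.Surjective q) (hq' : Function.Surjective q')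
    (h : Function.Injective ((LinearMap.ker q').subtype.lTensor X)) :
    Function.Injective ((LinearMap.ker q).subtype.lTensor X) := by
  obtain ⟨a, ha⟩ := Module.projective_lifting_property q' q hq'
  obtain ⟨b, hb⟩ := Module.projective_lifting_property q q' hq
  have hab : ∀ x, q (b (a x)) = q x := fun x => by
    rw [← LinearMap.comp_apply q b, hb, ← LinearMap.comp_apply q' a, ha]
  let a' : LinearMap.ker q →ₗ[R] LinearMap.ker q' := a.restrict fun x hx => by
    rw [LinearMap.mem_ker] at hx ⊢
    rw [← LinearMap.comp_apply, ha, hx]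
  let b' : LinearMap.ker q' →ₗ[R] LinearMap.ker q := b.restrict fun x hx => by
    rw [LinearMap.mem_ker] at hx ⊢
    rw [← LinearMap.comp_apply, hb, hx]
  let d : P →ₗ[R] LinearMap.ker q := (LinearMap.id - b ∘ₗ a).codRestrict _ fun x => by
    simp [hab]
  -- On `ker q` the round trip through `q'` differs from the identity by a map that factors through
  -- `P`; both terms kill `z` after tensoring.
  have hd : b' ∘ₗ a' + d ∘ₗ (LinearMap.ker q).subtype = LinearMap.id := by
    ext x
    simp [a', b', d]
  rw [injective_iff_map_eq_zero]
  intro z hz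
  have h1 : a'.lTensor X z = 0 := by
    apply h
    rw [map_zero, ← LinearMap.lTensor_comp_apply,
      show (LinearMap.ker q').subtype ∘ₗ a' = a ∘ₗ (LinearMap.ker q).subtype from rfl,
      LinearMap.lTensor_comp_apply, hz, map_zero]
  calc z = (LinearMap.id (R := R) (M := LinearMap.ker q)).lTensor X z := by simp
    _ = 0 := by
      rw [← hd, LinearMap.lTensor_add, LinearMap.add_apply, LinearMap.lTensor_comp_apply,
        LinearMap.lTensor_comp_apply, h1, hz, map_zero, map_zero, add_zero]

/-- Right exactness identifies `X ⊗ ker q` with the cokernel of `X ⊗ d₂`, so the homology at `X ⊗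
P₁` is the kernel of `X ⊗ ker q → X ⊗ P₀`. -/
theorem lTensor_exact_iff_lTensor_ker_injective {X P₂ P₁ P₀ N : Type*} [AddCommGroup X]
    [Module R X] [AddCommGroup P₂] [Module R P₂] [AddCommGroup P₁] [Module R P₁]
    [AddCommGroup P₀] [Module R P₀] [AddCommGroup N] [Module R N]
    {d₂ : P₂ →ₗ[R] P₁} {d₁ : P₁ →ₗ[R] P₀} {q : P₀ →ₗ[R] N}
    (h₁ : Function.Exact d₂ d₁) (h₀ : Function.Exact d₁ q) :
    Function.Exact (d₂.lTensor X) (d₁.lTensor X) ↔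
      Function.Injective ((LinearMap.ker q).subtype.lTensor X) := by
  let e : P₁ →ₗ[R] LinearMap.ker q := d₁.codRestrict _ fun x => h₀.apply_apply_eq_zero x
  have he : Function.Surjective e := by
    rintro ⟨y, hy⟩
    obtain ⟨x, rfl⟩ := (h₀ y).1 hy
    exact ⟨x, rfl⟩
  have hex : Function.Exact d₂ e := fun x => by
    rw [← h₁ x, Subtype.ext_iff]
    rfl
  have hX := lTensor_exact X hex he
  have hcomp : ∀ z, (LinearMap.ker q).subtype.lTensor X (e.lTensor X z) = d₁.lTensor X z :=
    fun z => by rw [← LinearMap.lTensor_comp_apply]; rfl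
  constructor
  · intro h
    rw [injective_iff_map_eq_zero]
    intro z hz
    obtain ⟨w, rfl⟩ := LinearMap.lTensor_surjective X he z
    rw [hcomp] at hz
    exact (hX w).2 ((h w).1 hz)
  · intro h z
    rw [← hX z, ← hcomp, map_eq_zero_iff _ h]

theorem torOneVanishes_iff_of_surjective {X N P : Type u} [AddCommGroup X] [Module R X]
    [AddCommGroup N] [Module R N] [AddCommGroup P] [Module R P] [Module.Projective R P]
    {q : P →ₗ[R] N} (hq : Function.Surjective q) :
    TorOneVanishes R X N ↔ Function.Injective ((LinearMap.ker q).subtype.lTensor X) := by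
  let C := ProjectiveResolution.of (ModuleCat.of R N)
  let F := (MonoidalCategory.tensoringLeft (ModuleCat.{u} R)).obj (ModuleCat.of R X)
  have h0 := (ShortComplex.ShortExact.moduleCat_exact_iff_function_exact _).1 C.exact₀
  have h1 := (ShortComplex.ShortExact.moduleCat_exact_iff_function_exact _).1 (C.exact_succ 0)
  have hs : Function.Surjective (C.π.f 0).hom :=
    (ModuleCat.epi_iff_surjective _).1 inferInstance
  have : Module.Projective R (C.complex.X 0) :=
    (IsProjective.iff_projective (C.complex.X 0)).2 (C.projective 0)
  have key : TorOneVanishes R X N ↔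
      Function.Exact ((C.complex.d 2 1).hom.lTensor X) ((C.complex.d 1 0).hom.lTensor X) := by
    have e := C.isoLeftDerivedObj F 1
    unfold TorOneVanishes
    rw [Tor_obj, e.isZero_iff, HomologicalComplex.homologyFunctor_obj,
      ← HomologicalComplex.exactAt_iff_isZero_homology,
      HomologicalComplex.exactAt_iff' _ 2 1 0 (by simp) (by simp),
      ShortComplex.ShortExact.moduleCat_exact_iff_function_exact]
    rfl
  rw [key]
  refine (lTensor_exact_iff_lTensor_ker_injective (q := (C.π.f 0).hom) h1 h0).trans
    ⟨fun h => ?_, fun h => ?_⟩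
  · exact lTensor_ker_injective_of_projective hq hs h
  · exact lTensor_ker_injective_of_projective hs hq h

end Tor

/-! ### Ext¹ as the obstruction to extending maps from a kernel -/

section Ext

variable {R : Type u} [CommRing R]

theorem exists_extension_of_extOneVanishes {M N P : Type u} [AddCommGroup M] [Module R M]
    [AddCommGroup N] [Module R N] [AddCommGroup P] [Module R P]
    {q : P →ₗ[R] M} (hq : Function.Surjective q) (h : ExtOneVanishes R M N)
    (φ : LinearMap.ker q →ₗ[R] N) : ∃ ψ : P →ₗ[R] N, ψ ∘ₗ (LinearMap.ker q).subtype = φ := by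
  have hS := LinearMap.shortExact_shortComplexKer hq
  have : Subsingleton (Abelian.Ext (ModuleCat.of R M) (ModuleCat.of R N) 1) := h
  obtain ⟨x, hx⟩ := Abelian.Ext.contravariant_sequence_exact₁ hS (ModuleCat.of R N)
    (Abelian.Ext.mk₀ (ModuleCat.ofHom φ)) (add_zero 1) (Subsingleton.elim _ _)
  obtain ⟨ψ, rfl⟩ := Abelian.Ext.homEquiv₀.symm.surjective x
  refine ⟨ψ.hom, ?_⟩
  rw [Abelian.Ext.homEquiv₀_symm_apply, Abelian.Ext.mk₀_comp_mk₀] at hx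
  have := (Abelian.Ext.mk₀_bijective _ _).1 hx
  exact congrArg ModuleCat.Hom.hom this

/-- Since `Ext¹(P, N) = 0`, the connecting map from `Hom(ker q, N)` onto `Ext¹(M, N)` is surjective.
-/
theorem extOneVanishes_of_subsingleton_hom {M N P : Type u} [AddCommGroup M] [Module R M]
    [AddCommGroup N] [Module R N] [AddCommGroup P] [Module R P] [Module.Projective R P]
    {q : P →ₗ[R] M} (hq : Function.Surjective q)
    (h : ∀ φ : LinearMap.ker q →ₗ[R] N, φ = 0) : ExtOneVanishes R M N := by
  have hS := LinearMap.shortExact_shortComplexKer hq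
  have : Projective (ModuleCat.of R P) := (IsProjective.iff_projective _).1 inferInstance
  have : ∀ x : Abelian.Ext (ModuleCat.of R M) (ModuleCat.of R N) 1, x = 0 := fun x => by
    obtain ⟨y, rfl⟩ := Abelian.Ext.contravariant_sequence_exact₃ hS (ModuleCat.of R N) x
      (Abelian.Ext.eq_zero_of_projective _) (add_zero 1)
    obtain ⟨φ, rfl⟩ := Abelian.Ext.homEquiv₀.symm.surjective y
    have : φ = 0 := ModuleCat.hom_ext (h φ.hom)
    rw [this, Abelian.Ext.homEquiv₀_symm_apply, Abelian.Ext.mk₀_zero, Abelian.Ext.comp_zero]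
  exact ⟨fun x y => by rw [this x, this y]⟩

end Ext

/-! ### Uniqueness of minimal free covers -/

section MinimalCover

variable {R : Type*} [CommRing R] [IsLocalRing R]

/-- Nakayama gives surjectivity, and a surjective endomorphism of a finite module is injective. -/
theorem bijective_of_sub_mem_maximalIdeal {n : ℕ} (u : (Fin n → R) →ₗ[R] (Fin n → R))
    (hu : ∀ x i, (x - u x) i ∈ IsLocalRing.maximalIdeal R) : Function.Bijective u := by
  have hs : Function.Surjective u := by
    rw [← LinearMap.range_eq_top, ← top_le_iff]
    refine Submodule.le_of_le_smul_of_le_jacobson_bot (I := IsLocalRing.maximalIdeal R)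
      Module.Finite.fg_top (IsLocalRing.jacobson_eq_maximalIdeal ⊥ bot_ne_top).ge ?_
    intro x _
    have hx : x = u x + (x - u x) := by simp
    rw [hx]
    refine Submodule.add_mem_sup ⟨x, rfl⟩ ?_
    rw [pi_eq_sum_univ' (x - u x)]
    exact Submodule.sum_mem _ fun i _ => Submodule.smul_mem_smul (hu x i) trivial
  exact ⟨OrzechProperty.injective_of_surjective_endomorphism u hs, hs⟩

/-- Minimal free covers of a module over a local ring are unique up to isomorphism. -/
theorem exists_equiv_of_minimalCover {X : Type*} [AddCommGroup X] [Module R X] {n k : ℕ}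
    {g : (Fin n → R) →ₗ[R] X} {g' : (Fin k → R) →ₗ[R] X}
    (hg : Function.Surjective g) (hg' : Function.Surjective g')
    (hm : ∀ x ∈ LinearMap.ker g, ∀ i, x i ∈ IsLocalRing.maximalIdeal R)
    (hm' : ∀ x ∈ LinearMap.ker g', ∀ i, x i ∈ IsLocalRing.maximalIdeal R) :
    ∃ e : (Fin n → R) ≃ₗ[R] (Fin k → R), ∀ x, g' (e x) = g x := by
  obtain ⟨a, ha⟩ := Module.projective_lifting_property g' g hg'
  obtain ⟨b, hb⟩ := Module.projective_lifting_property g g' hg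
  have ha' : ∀ x, g' (a x) = g x := fun x => LinearMap.congr_fun ha x
  have hb' : ∀ x, g (b x) = g' x := fun x => LinearMap.congr_fun hb x
  have h1 := bijective_of_sub_mem_maximalIdeal (b ∘ₗ a) fun x => hm _ (by simp [ha', hb'])
  have h2 := bijective_of_sub_mem_maximalIdeal (a ∘ₗ b) fun x => hm' _ (by simp [ha', hb'])
  rw [LinearMap.coe_comp] at h1 h2
  exact ⟨LinearEquiv.ofBijective a ⟨h1.1.of_comp, h2.2.of_comp⟩, ha'⟩

end MinimalCover

/-! ### Identification of `λM` with the image of `f^*` -/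

section Lam

variable {R : Type u} [CommRing R] [IsLocalRing R] [IsNoetherianRing R]
  {M : Type*} [AddCommGroup M] [Module R M] [Module.Finite R M]

/-- `λ M` is the image of `f^* : F₀^* → F₁^*` for the minimal presentation `F₁ → F₀ → M → 0`. -/
theorem nonempty_lam_equiv :
    Nonempty (Lam R M ≃ₗ[R] LinearMap.range (minimalPresentation R M).f.dualMap) := by
  let P := minimalPresentation R M
  let Q := minimalPresentation R (Transpose R M)
  let b : (Fin P.m → R) ≃ₗ[R] Module.Dual R (Fin P.m → R) := (Pi.basisFun R (Fin P.m)).toDualEquiv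
  let g' : (Fin P.m → R) →ₗ[R] Transpose R M :=
    (LinearMap.range P.f.dualMap).mkQ ∘ₗ b.toLinearMap
  have hker : ∀ x, x ∈ LinearMap.ker g' ↔ b x ∈ LinearMap.range P.f.dualMap := fun x => by
    simp [g']
  have hg' : Function.Surjective g' :=
    (Submodule.mkQ_surjective _).comp b.surjective
  -- The matrix of `f^*` is the transpose of that of `f`, whose entries lie in the maximal ideal
  -- because `im f = ker g`. Hence `F₁^* → Tr M` is already a minimal cover.
  have hm' : ∀ x ∈ LinearMap.ker g', ∀ i, x i ∈ IsLocalRing.maximalIdeal R := by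
    intro x hx i
    obtain ⟨φ, hφ⟩ := (hker x).1 hx
    have hxi : x i = φ (P.f (Pi.single i 1)) := by
      rw [← LinearMap.dualMap_apply, hφ]
      simpa [b] using ((Pi.basisFun R (Fin P.m)).toDual_apply_left x i).symm
    rw [hxi, pi_eq_sum_univ' (P.f _), map_sum]
    refine Ideal.sum_mem _ fun j _ => ?_
    rw [map_smul, smul_eq_mul]
    refine Ideal.mul_mem_right _ _ (P.ker_g_minimal _ ?_ j)
    exact P.exact.apply_apply_eq_zero _
  obtain ⟨e, he⟩ := exists_equiv_of_minimalCover Q.surjective hg' Q.ker_g_minimal hm'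
  refine ⟨(e.trans b).ofSubmodules _ _ ?_⟩
  ext y
  rw [Submodule.mem_map]
  constructor
  · rintro ⟨x, hx, rfl⟩
    have : Q.g x = 0 := (Q.exact x).2 hx
    exact (hker (e x)).1 (by rw [LinearMap.mem_ker, he, this])
  · intro hy
    refine ⟨(e.trans b).symm y, (Q.exact _).1 ?_, (e.trans b).apply_symm_apply y⟩
    rw [← he]
    refine (hker _).2 ?_
    simpa using hy

end Lam

/-! ### Associated primes and local tests -/

section AssociatedPrimes

variable {R : Type*} [CommRing R]

/-- A finitely generated module with support at `p` has a non-zero map to `R / p`. -/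
theorem exists_ne_zero_hom_quotient {X : Type*} [AddCommGroup X] [Module R X]
    [Module.Finite R X] {p : Ideal R} [p.IsPrime] (h : Module.annihilator R X ≤ p) :
    ∃ φ : X →ₗ[R] R ⧸ p, φ ≠ 0 := by
  -- The fibre of `X` at `p` is non-zero, so it carries a non-zero functional; clearing denominators
  -- on finitely many generators moves its values into `R / p`.
  have hnt : Nontrivial (TensorProduct R p.ResidueField X) := by
    refine (Module.mem_support_iff_nontrivial_residueField_tensorProduct
      (⟨p, ‹_›⟩ : PrimeSpectrum R)).1 ?_
    rw [Module.support_eq_zeroLocus]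
    exact h
  obtain ⟨v, hv⟩ := exists_ne (0 : TensorProduct R p.ResidueField X)
  obtain ⟨ψ, hψ⟩ := Module.Projective.exists_dual_ne_zero p.ResidueField hv
  let θ : X →ₗ[R] p.ResidueField := ψ.restrictScalars R ∘ₗ TensorProduct.mk R p.ResidueField X 1
  have hθ : θ ≠ 0 := by
    intro h0
    refine hψ ?_
    have : ψ = 0 := by
      refine TensorProduct.AlgebraTensorModule.curry_injective (LinearMap.ext_ring ?_)
      exact LinearMap.ext fun x => LinearMap.congr_fun h0 x
    rw [this, LinearMap.zero_apply]
  obtain ⟨T, hT⟩ := Module.Finite.fg_top (R := R) (M := X)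
  obtain ⟨b, hb⟩ := IsLocalization.exist_integer_multiples (nonZeroDivisors (R ⧸ p)) T θ
  let ι : (R ⧸ p) →ₗ[R] p.ResidueField :=
    (Algebra.linearMap (R ⧸ p) p.ResidueField).restrictScalars R
  have hι : Function.Injective ι := IsFractionRing.injective (R ⧸ p) p.ResidueField
  let c : p.ResidueField := algebraMap (R ⧸ p) p.ResidueField b
  have hc : c ≠ 0 := by
    rw [Ne, map_eq_zero_iff _ (IsFractionRing.injective (R ⧸ p) p.ResidueField)]
    exact nonZeroDivisors.coe_ne_zero b
  let θ' : X →ₗ[R] p.ResidueField := LinearMap.mulLeft R c ∘ₗ θ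
  have hrange : LinearMap.range θ' ≤ LinearMap.range ι := by
    rw [LinearMap.range_eq_map, ← hT, Submodule.map_span, Submodule.span_le]
    rintro _ ⟨t, ht, rfl⟩
    obtain ⟨y, hy⟩ := hb t ht
    exact ⟨y, hy.trans (Algebra.smul_def _ _)⟩
  let e := LinearEquiv.ofInjective ι hι
  refine ⟨e.symm.toLinearMap ∘ₗ θ'.codRestrict _ fun x => hrange ⟨x, rfl⟩, fun h0 => hθ ?_⟩
  ext x
  have hx := LinearMap.congr_fun h0 x
  rw [LinearMap.comp_apply, LinearMap.zero_apply, LinearEquiv.coe_coe,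
    LinearEquiv.map_eq_zero_iff, Subtype.ext_iff] at hx
  exact (mul_eq_zero.1 hx).resolve_left hc

variable [IsNoetherianRing R]

/-- If no single `x i` had annihilator `p`, each would be killed by some `s i ∉ p`. The finite
product of the `s i` kills the whole family, so it lies in `p`, contradicting primality. -/
theorem mem_associatedPrimes_of_forall_mem_iff {ι X : Type*} [Finite ι] [AddCommGroup X]
    [Module R X] {p : Ideal R} [p.IsPrime] (x : ι → X)
    (h : ∀ r, r ∈ p ↔ ∀ i, r • x i = 0) : p ∈ associatedPrimes R X := by
  classical
  cases nonempty_fintype ι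
  by_contra hp
  have : ∀ i, ∃ s ∉ p, s • x i = 0 := by
    intro i
    by_contra! hi
    refine hp (isAssociatedPrime_iff.2 ⟨‹_›, x i, ?_⟩)
    ext r
    rw [Submodule.mem_colon_singleton, Submodule.mem_bot]
    exact ⟨fun hr => (h r).1 hr i, fun hr => by_contra fun hrp => hi r hrp hr⟩
  choose s hs hsx using this
  have hmem : ∏ i, s i ∈ p := (h _).2 fun i => by
    rw [← Finset.prod_erase_mul _ _ (Finset.mem_univ i), mul_smul, hsx, smul_zero]
  obtain ⟨i, -, hi⟩ := (Ideal.IsPrime.prod_mem_iff).1 hmem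
  exact hs i hi

theorem associatedPrimes_subset_of_injective_pi {ι X : Type*} [Finite ι] [AddCommGroup X]
    [Module R X] {j : X →ₗ[R] (ι → R)} (hj : Function.Injective j) :
    associatedPrimes R X ⊆ associatedPrimes R R := by
  intro p hp
  obtain ⟨hpr, x, hx⟩ := isAssociatedPrime_iff.1 hp
  refine mem_associatedPrimes_of_forall_mem_iff (j x) fun r => ?_
  rw [hx, Submodule.mem_colon_singleton, Submodule.mem_bot, ← map_eq_zero_iff j hj, map_smul,
    funext_iff]
  rfl

/-- An element of a module vanishes if it vanishes locally at all associated primes. -/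
theorem eq_zero_of_forall_associatedPrimes {X : Type*} [AddCommGroup X] [Module R X]
    {x : X} (h : ∀ p ∈ associatedPrimes R X, ∃ s ∉ p, s • x = 0) : x = 0 := by
  by_contra hx
  obtain ⟨p, hp, hle⟩ := exists_le_isAssociatedPrime_of_isNoetherianRing R x hx
  obtain ⟨s, hs, hsx⟩ := h p hp
  exact hs (hle (Submodule.mem_colon_singleton.2 hsx))

end AssociatedPrimes

/-! ### Annihilators and functionals read off a presentation -/

section Presentation

variable {R : Type*} [CommRing R] {m n : ℕ} {f : (Fin m → R) →ₗ[R] (Fin n → R)}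
  {M N : Type*} [AddCommGroup M] [Module R M] [AddCommGroup N] [Module R N]
  {g : (Fin n → R) →ₗ[R] M}

/-- Pulling back coordinate functionals along `f` recovers the coordinates of `f x`, so killing `im
f^*` and killing `im f` are the same. -/
theorem mem_annihilator_iff_of_equiv_range_dualMap (e : N ≃ₗ[R] LinearMap.range f.dualMap)
    {r : R} : r ∈ Module.annihilator R N ↔ ∀ x, r • f x = 0 := by
  rw [e.annihilator_eq, Module.mem_annihilator]
  constructor
  · intro h x
    ext i
    have := h ⟨f.dualMap (LinearMap.proj i), LinearMap.mem_range_self _ _⟩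
    exact LinearMap.congr_fun (congrArg Subtype.val this) x
  · rintro h ⟨_, φ, rfl⟩
    ext x
    rw [Submodule.coe_smul, LinearMap.comp_apply, LinearMap.smul_apply, LinearMap.dualMap_apply,
      ← map_smul, h]
    simp

theorem smul_mem_range_of_mem_annihilator (hfg : Function.Exact f g) {r : R}
    (hr : r ∈ Module.annihilator R M) (x : Fin n → R) : r • x ∈ LinearMap.range f :=
  (hfg _).1 (by rw [map_smul, Module.mem_annihilator.1 hr])

theorem mul_eq_zero_of_mem_annihilator [NeZero n] (hfg : Function.Exact f g)
    (e : N ≃ₗ[R] LinearMap.range f.dualMap) {a b : R} (ha : a ∈ Module.annihilator R M)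
    (hb : b ∈ Module.annihilator R N) : a * b = 0 := by
  obtain ⟨y, hy⟩ := smul_mem_range_of_mem_annihilator hfg ha (Pi.single (0 : Fin n) 1)
  have h := congrFun ((mem_annihilator_iff_of_equiv_range_dualMap e).1 hb y) 0
  rw [hy] at h
  simpa [mul_comm] using h

variable {I J : Ideal R}

theorem apply_mem_of_mem_range (e : N ≃ₗ[R] LinearMap.range f.dualMap)
    (hlink : ∀ r, (∀ j ∈ Module.annihilator R N, r * j = 0) → r ∈ I)
    {x : Fin n → R} (hx : x ∈ LinearMap.range f) (i : Fin n) : x i ∈ I := by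
  obtain ⟨y, rfl⟩ := hx
  refine hlink _ fun j hj => ?_
  rw [mul_comm]
  exact congrFun ((mem_annihilator_iff_of_equiv_range_dualMap e).1 hj y) i

theorem apply_mem_of_mem_ker_dualMap (hfg : Function.Exact f g)
    (hlink : ∀ r, (∀ j ∈ Module.annihilator R M, r * j = 0) → r ∈ J)
    {φ : Module.Dual R (Fin n → R)} (hφ : φ ∈ LinearMap.ker f.dualMap) (x : Fin n → R) :
    φ x ∈ J := by
  refine hlink _ fun j hj => ?_
  obtain ⟨y, hy⟩ := smul_mem_range_of_mem_annihilator hfg hj x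
  rw [mul_comm, ← smul_eq_mul, ← map_smul, ← hy]
  exact LinearMap.congr_fun hφ y

/-- The evaluation pairing `M ⊗ ker f^* → R`. -/
noncomputable def evalPairing (hg : Function.Surjective g) (hfg : Function.Exact f g) :
    TensorProduct R M (LinearMap.ker f.dualMap) →ₗ[R] R :=
  TensorProduct.lift <| LinearMap.flip
    { toFun := fun φ => (LinearMap.ker g).liftQ φ.1 (by
          intro x hx
          obtain ⟨y, rfl⟩ := (hfg x).1 hx
          exact LinearMap.congr_fun φ.2 y) ∘ₗ
        (g.quotKerEquivOfSurjective hg).symm.toLinearMap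
      map_add' := fun φ ψ => by
        ext x
        obtain ⟨x, rfl⟩ := (g.quotKerEquivOfSurjective hg).surjective x
        obtain ⟨x, rfl⟩ := Submodule.mkQ_surjective _ x
        simp
      map_smul' := fun r φ => by
        ext x
        obtain ⟨x, rfl⟩ := (g.quotKerEquivOfSurjective hg).surjective x
        obtain ⟨x, rfl⟩ := Submodule.mkQ_surjective _ x
        simp }

theorem evalPairing_tmul (hg : Function.Surjective g) (hfg : Function.Exact f g)
    (x : Fin n → R) (φ : LinearMap.ker f.dualMap) :
    evalPairing hg hfg (TensorProduct.tmul R (g x) φ) = φ.1 x := by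
  have : (g.quotKerEquivOfSurjective hg).symm (g x) = (LinearMap.ker g).mkQ x := by
    rw [LinearEquiv.symm_apply_eq]
    rfl
  simp [evalPairing, this]

end Presentation

/-! ### Injectivity on tensor products with a module of functionals -/

section Tensor

open TensorProduct

variable {R : Type*} [CommRing R] {n : ℕ}
  {M : Type*} [AddCommGroup M] [Module R M] {g : (Fin n → R) →ₗ[R] M}

theorem exists_eq_sum_tmul (hg : Function.Surjective g) {L : Type*} [AddCommMonoid L] [Module R L]
    (z : M ⊗[R] L) : ∃ φ : Fin n → L, z = ∑ i, g (Pi.single i 1) ⊗ₜ[R] φ i := by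
  induction z with
  | zero => exact ⟨0, by simp⟩
  | tmul x l =>
    obtain ⟨y, rfl⟩ := hg x
    refine ⟨fun i => y i • l, ?_⟩
    conv_lhs => rw [pi_eq_sum_univ' y, map_sum, sum_tmul]
    refine Finset.sum_congr rfl fun i _ => ?_
    rw [map_smul, smul_tmul]
  | add z w hz hw =>
    obtain ⟨φ, rfl⟩ := hz
    obtain ⟨ψ, rfl⟩ := hw
    exact ⟨φ + ψ, by simp [tmul_add, Finset.sum_add_distrib]⟩

/-- If `M ≅ (R/I)^n` and all functionals in `L` take values in `J` with `I ∩ J = 0`, then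
`M ⊗ L → M ⊗ (R^n)^*` is injective. -/
theorem lTensor_subtype_injective {I J : Ideal R} (hIJ : I ⊓ J = ⊥) (hg : Function.Surjective g)
    (hI : ∀ x ∈ LinearMap.ker g, ∀ i, x i ∈ I)
    {L : Submodule R (Module.Dual R (Fin n → R))} (hL : ∀ φ ∈ L, ∀ x, φ x ∈ J) :
    Function.Injective (L.subtype.lTensor M) := by
  rw [injective_iff_map_eq_zero]
  intro z hz
  obtain ⟨φ, rfl⟩ := exists_eq_sum_tmul hg z
  have key : ∀ i x, (φ i).1 x ∈ I := by
    intro i x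
    -- The `i`-th coordinate modulo `I` is well defined on `M`. Paired with evaluation at `x`, it
    -- extracts `φ i x` modulo `I` from the tensor.
    let c : M →ₗ[R] R ⧸ I := (LinearMap.ker g).liftQ (I.mkQ ∘ₗ LinearMap.proj i) (by
        intro y hy
        simpa [Ideal.Quotient.eq_zero_iff_mem] using! hI y hy i) ∘ₗ
      (g.quotKerEquivOfSurjective hg).symm.toLinearMap
    have hc : ∀ y, c (g y) = I.mkQ (y i) := fun y => by
      have : (g.quotKerEquivOfSurjective hg).symm (g y) = (LinearMap.ker g).mkQ y := by
        rw [LinearEquiv.symm_apply_eq]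
        rfl
      simp [c, this]
    let B : M ⊗[R] Module.Dual R (Fin n → R) →ₗ[R] R ⧸ I :=
      TensorProduct.lift ((LinearMap.lsmul R (R ⧸ I)).flip.compl₂ (Module.Dual.eval R _ x) ∘ₗ c)
    have h := congrArg B hz
    rw [map_zero, map_sum, map_sum, Finset.sum_eq_single i] at h
    · rw [← Ideal.Quotient.eq_zero_iff_mem]
      have h' : (φ i).1 x • c (g (Pi.single i 1)) = 0 := h
      rw [hc, ← map_smul] at h'
      simpa using h'
    · intro j _ hj
      have : B (L.subtype.lTensor M (g (Pi.single j 1) ⊗ₜ φ j)) =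
        (φ j).1 x • c (g (Pi.single j 1)) := rfl
      rw [this, hc, Pi.single_eq_of_ne hj.symm, map_zero, smul_zero]
    · simp
  refine Finset.sum_eq_zero fun i _ => ?_
  have : φ i = 0 := by
    refine Subtype.ext (LinearMap.ext fun x => ?_)
    have : (φ i).1 x ∈ I ⊓ J := ⟨key i x, hL _ (φ i).2 x⟩
    rw [hIJ] at this
    exact this
  rw [this, tmul_zero]

end Tensor

/-! ### Annihilators, colon ideals and associated primes -/

section Annihilator

variable {R : Type u} [CommRing R]

theorem annihilator_le_of_mem_associatedPrimes {X : Type*} [AddCommGroup X] [Module R X]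
    {p : Ideal R} (hp : p ∈ associatedPrimes R X) : Module.annihilator R X ≤ p := by
  rw [← Submodule.annihilator_top]
  exact IsAssociatedPrime.annihilator_le hp

theorem eq_colon_bot_iff {I J : Ideal R} :
    I = Submodule.colon ⊥ (J : Set R) ↔ ∀ r, r ∈ I ↔ ∀ j ∈ J, r * j = 0 := by
  rw [SetLike.ext_iff]
  exact forall_congr' fun r => by rw [Submodule.mem_colon]; rfl

theorem isFreeOverQuotientAnnihilator_of_forall_mem_ker {M : Type u} [AddCommGroup M]
    [Module R M] {n : ℕ} {g : (Fin n → R) →ₗ[R] M}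
    (hg : Function.Surjective g)
    (h : ∀ x ∈ LinearMap.ker g, ∀ i, x i ∈ Module.annihilator R M) :
    IsFreeOverQuotientAnnihilator R M := by
  let : Module (R ⧸ Module.annihilator R M) M := Module.quotientAnnihilator
  have hsmul : ∀ (r : R) (x : M), Ideal.Quotient.mk (Module.annihilator R M) r • x = r • x :=
    fun _ _ => rfl
  let v : Fin n → M := fun i => g (Pi.single i 1)
  have hv : ∀ x : Fin n → R,
      ∑ i, Ideal.Quotient.mk (Module.annihilator R M) (x i) • v i = g x := fun x => by
    conv_rhs => rw [pi_eq_sum_univ' x, map_sum]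
    exact Finset.sum_congr rfl fun i _ => by rw [map_smul, hsmul]
  have hli : LinearIndependent (R ⧸ Module.annihilator R M) v := by
    rw [Fintype.linearIndependent_iff]
    intro c hc i
    choose r hr using fun i => Ideal.Quotient.mk_surjective (c i)
    rw [← hr, Ideal.Quotient.eq_zero_iff_mem]
    refine h r ?_ i
    rw [LinearMap.mem_ker, ← hv, ← hc]
    exact Finset.sum_congr rfl fun i _ => by rw [hr]
  refine Module.Free.of_basis (Module.Basis.mk hli fun y _ => ?_)
  obtain ⟨x, rfl⟩ := hg y
  rw [← hv]
  exact Submodule.sum_mem _ fun i _ => Submodule.smul_mem _ _ (Submodule.subset_span ⟨i, rfl⟩)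

variable [IsNoetherianRing R]

/-- A minimal prime of `R` that contains the annihilator is minimal over it. -/
theorem mem_associatedPrimes_of_annihilator_le {X : Type*} [AddCommGroup X] [Module R X]
    [Module.Finite R X] {p : Ideal R} (hp : p ∈ minimalPrimes R)
    (h : Module.annihilator R X ≤ p) : p ∈ associatedPrimes R X :=
  Module.associatedPrimes.minimalPrimes_annihilator_subset_associatedPrimes R X
    ⟨⟨hp.1.1, h⟩, fun _ hq hle => hp.2 ⟨hq.1, bot_le⟩ hle⟩

/-- If `p` is the annihilator of the class of `x` modulo `I = (0 : J)`, it is the common annihilator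
of the products `x * t`, with `t` running over finitely many generators of `J`. -/
theorem mem_associatedPrimes_of_mem_associatedPrimes_quotient {I J : Ideal R}
    (h : ∀ r, r ∈ I ↔ ∀ j ∈ J, r * j = 0) {p : Ideal R}
    (hp : p ∈ associatedPrimes R (R ⧸ I)) : p ∈ associatedPrimes R R := by
  obtain ⟨hpr, x, hx⟩ := isAssociatedPrime_iff.1 hp
  obtain ⟨x, rfl⟩ := Ideal.Quotient.mk_surjective x
  obtain ⟨T, hT⟩ := (isNoetherianRing_iff_ideal_fg R).1 inferInstance J
  refine mem_associatedPrimes_of_forall_mem_iff (fun t : T => x * t) fun r => ?_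
  rw [hx, Submodule.mem_colon_singleton, Submodule.mem_bot, ← Ideal.Quotient.mk_eq_mk,
    ← Submodule.Quotient.mk_smul, Submodule.Quotient.mk_eq_zero, h]
  constructor
  · intro hr t
    rw [smul_eq_mul, ← mul_assoc]
    exact hr t (hT ▸ Ideal.subset_span t.2)
  · intro hr j hj
    have hle : J ≤ LinearMap.ker (LinearMap.mulLeft R (r • x)) := by
      rw [← hT]
      refine Ideal.span_le.2 fun t ht => ?_
      have := hr ⟨t, ht⟩
      rwa [smul_eq_mul, ← mul_assoc] at this
    exact hle hj

/-- At each associated prime of `X` some element of `J` becomes a unit, so `r`, which kills `J`,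
vanishes there. -/
theorem mem_of_forall_mul_eq_zero {X : Type*} [AddCommGroup X] [Module R X]
    (hass : associatedPrimes R X ⊆ associatedPrimes R R) {J : Ideal R}
    (h : ∀ p ∈ associatedPrimes R R, Module.annihilator R X ≤ p → ¬ J ≤ p)
    (r : R) (hr : ∀ j ∈ J, r * j = 0) : r ∈ Module.annihilator R X := by
  refine Module.mem_annihilator.2 fun x =>
    eq_zero_of_forall_associatedPrimes (R := R) fun p hp => ?_
  obtain ⟨s, hs, hsp⟩ := SetLike.not_le_iff_exists.1 (h p (hass hp)
    (annihilator_le_of_mem_associatedPrimes hp))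
  exact ⟨s, hsp, by rw [smul_smul, mul_comm, hr s hs, zero_smul]⟩

theorem ne_bot_of_forall_not_le {X : Type*} [AddCommGroup X] [Module R X] [Nontrivial X]
    (hass : associatedPrimes R X ⊆ associatedPrimes R R) {J : Ideal R}
    (h : ∀ p ∈ associatedPrimes R R, Module.annihilator R X ≤ p → ¬ J ≤ p) : J ≠ ⊥ := by
  rintro rfl
  obtain ⟨p, hp⟩ := associatedPrimes.nonempty R X
  exact h p (hass hp) (annihilator_le_of_mem_associatedPrimes hp) bot_le

theorem associatedPrimes_subset_of_equiv_range_dualMap {N : Type*}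
    [AddCommGroup N] [Module R N] {m n : ℕ}
    {f : (Fin m → R) →ₗ[R] (Fin n → R)} (e : N ≃ₗ[R] LinearMap.range f.dualMap) :
    associatedPrimes R N ⊆ associatedPrimes R R :=
  associatedPrimes_subset_of_injective_pi (j := (Pi.basisFun R (Fin m)).toDualEquiv.symm.toLinearMap
    ∘ₗ (LinearMap.range f.dualMap).subtype ∘ₗ e.toLinearMap)
    ((Pi.basisFun R (Fin m)).toDualEquiv.symm.injective.comp
      (Subtype.val_injective.comp e.injective))

end Annihilator

/-! ### Minimal covers of modules free over `R / Ann M` -/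

section FreeCover

variable {R : Type u} [CommRing R] [IsLocalRing R] {M : Type u} [AddCommGroup M] [Module R M]

/-- A basis over `R / Ann M` lifts to a minimal cover whose kernel has coordinates in `Ann M`.
Uniqueness of minimal covers carries this to `g`. -/
theorem mem_annihilator_of_isFreeOverQuotientAnnihilator [Module.Finite R M] [Nontrivial M] {n : ℕ}
    {g : (Fin n → R) →ₗ[R] M} (hg : Function.Surjective g)
    (hm : ∀ x ∈ LinearMap.ker g, ∀ i, x i ∈ IsLocalRing.maximalIdeal R)
    (h : IsFreeOverQuotientAnnihilator R M) {x : Fin n → R} (hx : x ∈ LinearMap.ker g)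
    (i : Fin n) : x i ∈ Module.annihilator R M := by
  let : Module (R ⧸ Module.annihilator R M) M := Module.quotientAnnihilator
  have hsmul : ∀ (r : R) (x : M), Ideal.Quotient.mk (Module.annihilator R M) r • x = r • x :=
    fun _ _ => rfl
  have : IsScalarTower R (R ⧸ Module.annihilator R M) M := .of_algebraMap_smul hsmul
  have : Module.Finite (R ⧸ Module.annihilator R M) M := .of_restrictScalars_finite R _ _
  have : Module.Free (R ⧸ Module.annihilator R M) M := h
  have hI : Module.annihilator R M ≠ ⊤ := by
    rw [Ne, Module.annihilator_eq_top_iff]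
    exact not_subsingleton M
  have : Nontrivial (R ⧸ Module.annihilator R M) := Ideal.Quotient.nontrivial_iff.2 hI
  let b := Module.finBasis (R ⧸ Module.annihilator R M) M
  let g' := Fintype.linearCombination R b
  have hg'mk : ∀ y, g' y = ∑ i, Ideal.Quotient.mk (Module.annihilator R M) (y i) • b i := fun y => by
    simp only [hsmul]
    rfl
  have hg' : Function.Surjective g' := fun y => by
    choose r hr using fun i => Ideal.Quotient.mk_surjective (b.repr y i)
    refine ⟨r, ?_⟩
    rw [hg'mk]
    simp only [hr]
    exact b.sum_repr y
  have hker : ∀ y ∈ LinearMap.ker g', ∀ i, y i ∈ Module.annihilator R M := fun y hy i => by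
    rw [LinearMap.mem_ker, hg'mk] at hy
    exact Ideal.Quotient.eq_zero_iff_mem.1
      (Fintype.linearIndependent_iff.1 b.linearIndependent _ hy i)
  obtain ⟨e, he⟩ := exists_equiv_of_minimalCover hg hg' hm
    fun y hy i => IsLocalRing.le_maximalIdeal hI (hker y hy i)
  have hx' : e x ∈ LinearMap.ker g' := by rw [LinearMap.mem_ker, he, hx]
  have hxe : x = ∑ j, e x j • e.symm (Pi.single j 1) := by
    rw [← e.symm_apply_apply x]
    conv_lhs => rw [pi_eq_sum_univ' (e x), map_sum]
    simp
  rw [hxe, Finset.sum_apply]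
  exact Ideal.sum_mem _ fun j _ => Ideal.mul_mem_right _ _ (hker _ hx' j)

end FreeCover

/-! ### The equivalences -/

section Main

variable {R : Type u} [CommRing R] [IsLocalRing R] [IsNoetherianRing R]
  {M N : Type u} [AddCommGroup M] [Module R M] [AddCommGroup N] [Module R N]

theorem nontrivial_of_equiv_syzygy_transpose [Nontrivial M] [Module.Finite R N]
    (e : M ≃ₗ[R] Syzygy R (Transpose R N)) : Nontrivial N := by
  by_contra hN
  rw [not_nontrivial_iff_subsingleton] at hN
  have hn : (minimalPresentation R N).n = 0 := by
    by_contra h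
    -- If `N = 0`, the all-ones vector lies in the kernel, and minimality would put `1` in the
    -- maximal ideal.
    have := (minimalPresentation R N).ker_g_minimal (fun _ => 1) (Subsingleton.elim _ _)
      ⟨0, Nat.pos_of_ne_zero h⟩
    exact (Ideal.ne_top_iff_one _).1 (IsLocalRing.maximalIdeal.isMaximal R).ne_top this
  obtain ⟨e'⟩ := nonempty_lam_equiv (R := R) (M := N)
  have : IsEmpty (Fin (minimalPresentation R N).n) := by rw [hn]; infer_instance
  have : Subsingleton (LinearMap.range (minimalPresentation R N).f.dualMap) := by
    refine ⟨?_⟩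
    rintro ⟨_, φ, rfl⟩ ⟨_, ψ, rfl⟩
    rw [Subsingleton.elim φ ψ]
  exact not_subsingleton M (e.trans e').toEquiv.subsingleton

/-- The equivalences for a module `M` and the module `N = im f^*` given by a minimal presentation
of `M`, if the associated primes of both modules are associated primes of `R`. -/
theorem tfae_of_minimalPresentation (hunm : IsUnmixedRing R) [Module.Finite R M]
    [Module.Finite R N] [Nontrivial M] [Nontrivial N] (P : MinimalPresentation R M)
    (e : N ≃ₗ[R] LinearMap.range P.f.dualMap)
    (hM : associatedPrimes R M ⊆ associatedPrimes R R)
    (hN : associatedPrimes R N ⊆ associatedPrimes R R) :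
    List.TFAE
      [associatedPrimes R M ∩ associatedPrimes R N = ∅,
       IsGeometricallyLinked (Module.annihilator R M) (Module.annihilator R N),
       IsLinked (Module.annihilator R M) (Module.annihilator R N) ∧ TorOneVanishes R M N,
       IsFreeOverQuotientAnnihilator R M ∧ ExtOneVanishes R M M] := by
  set I := Module.annihilator R M with hIdef
  set J := Module.annihilator R N with hJdef
  have hn : NeZero P.n := ⟨fun h => by
    have : IsEmpty (Fin P.n) := by rw [h]; infer_instance
    exact not_subsingleton M P.surjective.subsingleton⟩
  have hmul : ∀ a ∈ I, ∀ b ∈ J, a * b = 0 := fun a ha b hb =>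
    mul_eq_zero_of_mem_annihilator P.exact e ha hb
  have hItop : I ≠ ⊤ := by
    rw [hIdef, Ne, Module.annihilator_eq_top_iff]
    exact not_subsingleton M
  have hJtop : J ≠ ⊤ := by
    rw [hJdef, Ne, Module.annihilator_eq_top_iff]
    exact not_subsingleton N
  have hdisj : associatedPrimes R M ∩ associatedPrimes R N = ∅ ↔
      ∀ p ∈ associatedPrimes R R, I ≤ p → ¬ J ≤ p := by
    rw [Set.eq_empty_iff_forall_notMem]
    refine ⟨fun h p hp hIp hJp => h p ⟨?_, ?_⟩, fun h p hp => h p (hM hp.1)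
      (annihilator_le_of_mem_associatedPrimes hp.1) (annihilator_le_of_mem_associatedPrimes hp.2)⟩
    · exact mem_associatedPrimes_of_annihilator_le (hunm hp) hIp
    · exact mem_associatedPrimes_of_annihilator_le (hunm hp) hJp
  have hlinked : (∀ p ∈ associatedPrimes R R, I ≤ p → ¬ J ≤ p) → IsLinked I J := fun h =>
    { left_ne_bot := ne_bot_of_forall_not_le hN fun p hp hJp hIp => h p hp hIp hJp
      left_ne_top := hItop
      right_ne_bot := ne_bot_of_forall_not_le hM h
      right_ne_top := hJtop
      le_inf := bot_le
      left_eq := eq_colon_bot_iff.2 fun r =>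
        ⟨fun hr j hj => hmul r hr j hj, mem_of_forall_mul_eq_zero hM h r⟩
      right_eq := eq_colon_bot_iff.2 fun r =>
        ⟨fun hr j hj => by rw [mul_comm, hmul j hj r hr],
          mem_of_forall_mul_eq_zero hN (fun p hp hJp hIp => h p hp hIp hJp) r⟩ }
  have hker : IsLinked I J → ∀ x ∈ LinearMap.ker P.g, ∀ i, x i ∈ I := fun h x hx i =>
    apply_mem_of_mem_range e (fun r => (eq_colon_bot_iff.1 h.left_eq r).2) ((P.exact x).1 hx) i
  have hker' : IsLinked I J → ∀ φ ∈ LinearMap.ker P.f.dualMap, ∀ x, φ x ∈ J := fun h φ hφ x =>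
    apply_mem_of_mem_ker_dualMap P.exact (fun r => (eq_colon_bot_iff.1 h.right_eq r).2) hφ x
  have htor : TorOneVanishes R M N ↔
      Function.Injective ((LinearMap.ker P.f.dualMap).subtype.lTensor M) := by
    have hq : LinearMap.ker (e.symm.toLinearMap ∘ₗ P.f.dualMap.rangeRestrict) =
        LinearMap.ker P.f.dualMap := by
      rw [LinearEquiv.ker_comp, LinearMap.ker_rangeRestrict]
    rw [torOneVanishes_iff_of_surjective (q := e.symm.toLinearMap ∘ₗ P.f.dualMap.rangeRestrict)
      (e.symm.surjective.comp P.f.dualMap.surjective_rangeRestrict), hq]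
  tfae_have 1 → 2 := fun h =>
    { hlinked (hdisj.1 h) with
      disjoint_ass := by
        have hl := hlinked (hdisj.1 h)
        rw [Set.eq_empty_iff_forall_notMem]
        rintro p ⟨hpI, hpJ⟩
        refine hdisj.1 h p (mem_associatedPrimes_of_mem_associatedPrimes_quotient
          (eq_colon_bot_iff.1 hl.left_eq) hpI) ?_ ?_
        · exact Ideal.annihilator_quotient.ge.trans (annihilator_le_of_mem_associatedPrimes hpI)
        · exact Ideal.annihilator_quotient.ge.trans (annihilator_le_of_mem_associatedPrimes hpJ) }
  tfae_have 2 → 1 := fun h => by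
    refine hdisj.2 fun p hp hIp hJp => Set.eq_empty_iff_forall_notMem.1 h.disjoint_ass p ⟨?_, ?_⟩
    · exact mem_associatedPrimes_of_annihilator_le (hunm hp) (Ideal.annihilator_quotient.trans_le hIp)
    · exact mem_associatedPrimes_of_annihilator_le (hunm hp) (Ideal.annihilator_quotient.trans_le hJp)
  tfae_have 1 → 3 := fun h => by
    have hl := hlinked (hdisj.1 h)
    refine ⟨hl, htor.2 (lTensor_subtype_injective ?_ P.surjective (hker hl) (hker' hl))⟩
    rw [eq_bot_iff]
    rintro x ⟨hxI, hxJ⟩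
    rw [Submodule.mem_bot]
    refine eq_zero_of_forall_associatedPrimes (R := R) fun p hp => ?_
    -- As `IJ = 0`, an element of `I ∩ J` is killed by both ideals, and `p` fails to contain one of
    -- them.
    by_cases hIp : I ≤ p
    · obtain ⟨s, hs, hsp⟩ := SetLike.not_le_iff_exists.1 (hdisj.1 h p hp hIp)
      exact ⟨s, hsp, by rw [smul_eq_mul, mul_comm, hmul x hxI s hs]⟩
    · obtain ⟨s, hs, hsp⟩ := SetLike.not_le_iff_exists.1 hIp
      exact ⟨s, hsp, hmul s hs x hxJ⟩
  tfae_have 3 → 1 := by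
    rintro ⟨hl, ht⟩
    refine hdisj.2 fun p hp hIp hJp => ?_
    obtain ⟨hpr, x, hx⟩ := isAssociatedPrime_iff.1 hp
    have hpx : ∀ r ∈ p, x * r = 0 := fun r hr => by
      rw [hx, Submodule.mem_colon_singleton, Submodule.mem_bot, smul_eq_mul] at hr
      rw [mul_comm, hr]
    have hxI : x ∈ I := (eq_colon_bot_iff.1 hl.left_eq x).2 fun r hr => hpx r (hJp hr)
    have hxJ : x ∈ J := (eq_colon_bot_iff.1 hl.right_eq x).2 fun r hr => hpx r (hIp hr)
    -- Since `x ∈ J` kills `im f`, this functional lies in `ker f^*`. Tensored with the first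
    -- generator of `M` it dies in `M ⊗ F₀^*`, because `x ∈ I`, yet it pairs to `x`.
    let φ : Module.Dual R (Fin P.n → R) := x • LinearMap.proj 0
    have hφ : φ ∈ LinearMap.ker P.f.dualMap := by
      ext y
      exact congrFun ((mem_annihilator_iff_of_equiv_range_dualMap e).1 hxJ _) 0
    let z := TensorProduct.tmul R (P.g (Pi.single 0 1)) (⟨φ, hφ⟩ : LinearMap.ker P.f.dualMap)
    have hz : z = 0 := by
      refine htor.1 ht ?_
      rw [map_zero, LinearMap.lTensor_tmul, Submodule.subtype_apply, TensorProduct.tmul_smul,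
        TensorProduct.smul_tmul', Module.mem_annihilator.1 hxI, TensorProduct.zero_tmul]
    have hx0 : x = 0 := by
      have := evalPairing_tmul P.surjective P.exact (Pi.single 0 1) ⟨φ, hφ⟩
      rw [show TensorProduct.tmul R _ _ = z from rfl, hz, map_zero] at this
      simpa [φ] using this.symm
    refine hpr.ne_top ((Ideal.eq_top_iff_one p).2 ?_)
    rw [hx, hx0]
    simp
  tfae_have 1 → 4 := fun h => by
    have hl := hlinked (hdisj.1 h)
    refine ⟨isFreeOverQuotientAnnihilator_of_forall_mem_ker P.surjective (hker hl),
      extOneVanishes_of_subsingleton_hom P.surjective fun φ => ?_⟩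
    ext y
    rw [LinearMap.zero_apply]
    refine eq_zero_of_forall_associatedPrimes (R := R) fun p hp => ?_
    obtain ⟨s, hs, hsp⟩ := SetLike.not_le_iff_exists.1 (hdisj.1 h p (hM hp)
      (annihilator_le_of_mem_associatedPrimes hp))
    refine ⟨s, hsp, ?_⟩
    -- `J` kills `ΩM = im f`, so `s` kills every value of `φ`.
    obtain ⟨w, hw⟩ := (P.exact y.1).1 y.2
    have : s • y = 0 := Subtype.ext <| by
      rw [Submodule.coe_smul, ← hw, (mem_annihilator_iff_of_equiv_range_dualMap e).1 hs]
      rfl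
    rw [← map_smul, this, map_zero]
  tfae_have 4 → 1 := by
    rintro ⟨hfree, hext⟩
    refine hdisj.2 fun p hp hIp hJp => ?_
    have hpr : p.IsPrime := hp.1
    have hK : ∀ {x}, x ∈ LinearMap.ker P.g → ∀ i, x i ∈ I :=
      mem_annihilator_of_isFreeOverQuotientAnnihilator P.surjective P.ker_g_minimal hfree
    -- The coordinates of `im f` lie in `I`, so whatever kills `I` kills `im f` and hence belongs to
    -- `J`.
    have hann : Module.annihilator R I ≤ p := by
      refine le_trans (fun r hr => ?_) hJp
      refine (mem_annihilator_iff_of_equiv_range_dualMap e).2 fun x => ?_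
      ext i
      have := Module.mem_annihilator.1 hr
        ⟨P.f x i, hK (P.exact.apply_apply_eq_zero x) i⟩
      exact congrArg Subtype.val this
    obtain ⟨ψ, hψ⟩ := exists_ne_zero_hom_quotient hann
    obtain ⟨-, j, hj⟩ := (isAssociatedPrime_iff_exists_injective_linearMap _ _).1
      (mem_associatedPrimes_of_annihilator_le (X := M) (hunm hp) hIp)
    let c : LinearMap.ker P.g →ₗ[R] I :=
      (LinearMap.proj 0 ∘ₗ (LinearMap.ker P.g).subtype).codRestrict I fun x => hK x.2 0
    -- For `a ∈ I` the vector `a • e₀` lies in `ker g`, and an extension `θ` sends it to `a • θ e₀ =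
    -- 0`, which forces `ψ = 0`.
    obtain ⟨θ, hθ⟩ := exists_extension_of_extOneVanishes P.surjective hext (j ∘ₗ ψ ∘ₗ c)
    refine hψ (LinearMap.ext fun a => hj ?_)
    have hsingle : (Pi.single 0 a.1 : Fin P.n → R) = a.1 • Pi.single 0 1 := by
      rw [← Pi.single_smul, smul_eq_mul, mul_one]
    have hmem : Pi.single 0 a.1 ∈ LinearMap.ker P.g := by
      rw [LinearMap.mem_ker, hsingle, map_smul, Module.mem_annihilator.1 a.2]
    have hc : c ⟨_, hmem⟩ = a :=
      Subtype.ext (Pi.single_eq_same (M := fun _ : Fin P.n => R) 0 a.1)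
    have h1 := LinearMap.congr_fun hθ ⟨_, hmem⟩
    simp only [LinearMap.comp_apply, hc, Submodule.subtype_apply] at h1
    rw [← h1, LinearMap.zero_apply, map_zero, hsingle, map_smul]
    exact Module.mem_annihilator.1 a.2 _
  tfae_finish

end Main

end Linkage

theorem theorem1p3 {R : Type u} [CommRing R] [IsLocalRing R] [IsNoetherianRing R]
    (hGor : Linkage.IsGenericallyGorenstein R) (hunm : Linkage.IsUnmixedRing R)
    (hdim : 1 ≤ ringKrullDim R)
    {M : Type u} [AddCommGroup M] [Module R M] [Module.Finite R M] [Nontrivial M]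
    (hM : Linkage.IsHorizontallyLinked R M (Linkage.Lam R M)) :
    List.TFAE
      [associatedPrimes R M ∩ associatedPrimes R (Linkage.Lam R M) = ∅,
       Linkage.IsGeometricallyLinked (Module.annihilator R M)
         (Module.annihilator R (Linkage.Lam R M)),
       Linkage.IsLinked (Module.annihilator R M) (Module.annihilator R (Linkage.Lam R M)) ∧
         Linkage.TorOneVanishes R M (Linkage.Lam R M),
       Linkage.IsFreeOverQuotientAnnihilator R M ∧ Linkage.ExtOneVanishes R M M] := by
  obtain ⟨⟨e⟩, -⟩ := hM
  have : Nontrivial (Linkage.Lam R M) := Linkage.nontrivial_of_equiv_syzygy_transpose e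
  obtain ⟨eN⟩ := Linkage.nonempty_lam_equiv (R := R) (M := M)
  obtain ⟨eM⟩ := Linkage.nonempty_lam_equiv (R := R) (M := Linkage.Lam R M)
  exact Linkage.tfae_of_minimalPresentation hunm (Linkage.minimalPresentation R M) eN
    (Linkage.associatedPrimes_subset_of_equiv_range_dualMap (e.trans eM))
    (Linkage.associatedPrimes_subset_of_equiv_range_dualMap eN)
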